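/- Let $\mu\ge\nu>-1$. For $\lambda>-1$ and $x>0$ let $$J_\lambda(x)=\sum_{n\ge0}\frac{(-1)^n}{n!\,\Gamma(n+\lambda+1)}\Big(\frac x2\Big)^{2n+\lambda}$$ be the Bessel function of the first kind, and let $d_\lambda(x)=(1-\lambda)J_\lambda(x)+xJ_\lambda'(x)$ be the Dini function. Then $d_\nu$ has a smallest positive zero $\alpha_{\nu,1}$. On $[0,\alpha_{\nu,1}^2)$ define $$g_{\mu,\nu}(x)=x^{\frac{\nu-\mu}2}\,e^{\frac{3x}4\left(\frac1{\mu+1}-\frac1{\nu+1}\right)}\,\frac{d_\mu(\sqrt x)}{d_\nu(\sqrt x)},\qquad q_\nu(x)=\frac{x^{\frac\nu2}\,e^{-\frac{3x}{4(\nu+1)}}}{d_\nu(\sqrt x)}\qquad(x>0),$$ with the values at $x=0$ being the limits as $x\to0^+$, namely $g_{\mu,\nu}(0)=2^{\nu-\mu}\Gamma(\nu+1)/\Gamma(\mu+1)$ and $q_\nu(0)=2^\nu\Gamma(\nu+1)$. The functions $g_{\mu,\nu}$ and $q_\nu$ are positive on $[0,\alpha_{\nu,1}^2)$; put $f_{\mu,\nu}=(\log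 g_{\mu,\nu})'$ there (with the one-sided derivative at $0$). Then $f_{\mu,\nu}$, $g_{\mu,\nu}$ and $q_\nu$ are absolutely monotonic on $[0,\alpha_{\nu,1}^2)$, that is, they are infinitely differentiable there (one-sidedly at $0$) and all their derivatives of order $0,1,2,\dots$ are nonnegative. Moreover, if $\mu>\nu$, then $f_{\mu,\nu}(x)>0$ for all $x\in(0,\alpha_{\nu,1}^2)$. -/

import Mathlib

open Set

noncomputable section

namespace Dini

/-- The Bessel function of the first kind of real order `ν`,
`J_ν(x) = ∑ₙ (-1)ⁿ (x/2)^(2n+ν) / (n! Γ(n+ν+1))`, for real `x > 0`. -/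
def besselJ (ν x : ℝ) : ℝ :=
  ∑' n : ℕ, (-1 : ℝ) ^ n / ((n.factorial : ℝ) * Real.Gamma (n + ν + 1)) *
    (x / 2) ^ (2 * (n : ℝ) + ν)

/-- The Dini function `d_ν(x) = (1 - ν) J_ν(x) + x J_ν'(x)`, for real `x > 0`. -/
def d (ν x : ℝ) : ℝ :=
  (1 - ν) * besselJ ν x + x * deriv (besselJ ν) x

/-- The set of positive zeros of `d_ν`. -/
def posZeros (ν : ℝ) : Set ℝ := {x | 0 < x ∧ d ν x = 0}

/-- The first positive zero `α_{ν,1}` of `d_ν`. -/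
def alpha₁ (ν : ℝ) : ℝ := sInf (posZeros ν)

/-- The interval `[0, α_{ν,1}²)`. -/
def domain (ν : ℝ) : Set ℝ := Ico 0 (alpha₁ ν ^ 2)

/-- The function `g_{μ,ν}`; at `0`, where the formula is not defined, it takes the value
`2^(ν-μ) Γ(ν+1) / Γ(μ+1)`, its limit as `x → 0+`. -/
def g (μ ν x : ℝ) : ℝ :=
  if x = 0 then 2 ^ (ν - μ) * Real.Gamma (ν + 1) / Real.Gamma (μ + 1)
  else x ^ ((ν - μ) / 2) * Real.exp (3 * x / 4 * (1 / (μ + 1) - 1 / (ν + 1))) *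
    (d μ (√x) / d ν (√x))

/-- The function `f_{μ,ν} = (log g_{μ,ν})'` on `[0, α_{ν,1}²)`, with the one-sided derivative
at `0`. -/
def f (μ ν x : ℝ) : ℝ :=
  derivWithin (fun t => Real.log (g μ ν t)) (domain ν) x

/-- The function `q_ν`; at `0`, where the formula is not defined, it takes the value
`2^ν Γ(ν+1)`, its limit as `x → 0+`. -/
def q (ν x : ℝ) : ℝ :=
  if x = 0 then 2 ^ ν * Real.Gamma (ν + 1)
  else x ^ (ν / 2) * Real.exp (-(3 * x / (4 * (ν + 1)))) / d ν (√x)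

end Dini

end

/-!
Write `J_ν(x) = x ^ ν * B(x ^ 2)` and `d_ν(x) = x ^ ν * D(x ^ 2)` with entire power series `B` and
`D = B + 2 X B'`. Up to constants, the logarithmic derivatives of `q_ν` and `g_{μ,ν}` are
`L_ν = -D' / D` and `L_ν - L_μ`, the exponential factors cancelling their constant terms, so
everything follows once these two series have nonnegative coefficients.

Bessel's equation becomes the Riccati equation `X R' + (ν + 1) R = 1 / 4 + X R ^ 2` for
`R = -B' / B`. Comparing coefficients, it determines `R` by a recursion with nonnegative terms, and
the difference of the equations for `ν ≤ μ` does the same for `R_ν - R_μ`. As `D = B (1 - 2 X R)`,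
both properties pass to `L = R + (2 X R)' / (1 - 2 X R)`.

In particular `1 / D` has nonnegative coefficients. By Pringsheim's theorem the first singularity of
such a series lies on the positive axis, so `1 / D` converges up to the first positive zero of `D`.
There is one: otherwise `K = B / D = 1 / (1 - 2 X R)` would converge everywhere, whereas
`K(x) ≥ 1 + 2 R(0) x K(x)` is impossible at `x = 1 / (2 R(0))`.
-/

open PowerSeries Filter Topology
open scoped ContDiff ENNReal NNReal

noncomputable section

namespace Dini

section Convergence

variable {𝕜 : Type*} [NontriviallyNormedField 𝕜] {p q : 𝕜⟦X⟧} {r : ℝ≥0∞} {x : 𝕜}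

/-- A formal power series as a formal multilinear series, giving access to its radius of
convergence and to the theory of analytic functions. -/
def toFormalMultilinearSeries (p : 𝕜⟦X⟧) : FormalMultilinearSeries 𝕜 𝕜 𝕜 :=
  .ofScalars 𝕜 fun n => coeff n p

/-- The sum of a power series at a point; it is a junk value outside the disc of convergence. -/
def evalSum (p : 𝕜⟦X⟧) (x : 𝕜) : 𝕜 :=
  (toFormalMultilinearSeries p).sum x

theorem evalSum_eq_tsum (p : 𝕜⟦X⟧) (x : 𝕜) : evalSum p x = ∑' n, coeff n p * x ^ n :=
  FormalMultilinearSeries.ofScalars_sum_eq _ x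

theorem evalSum_C (c x : 𝕜) : evalSum (C c) x = c := by
  rw [evalSum_eq_tsum, tsum_eq_single 0 fun n hn => by rw [coeff_C, if_neg hn, zero_mul]]; simp

theorem evalSum_one (x : 𝕜) : evalSum (1 : 𝕜⟦X⟧) x = 1 :=
  evalSum_C 1 x

theorem evalSum_X (x : 𝕜) : evalSum (X : 𝕜⟦X⟧) x = x := by
  rw [evalSum_eq_tsum, tsum_eq_single 1 fun n hn => by rw [coeff_X, if_neg hn, zero_mul]]; simp

theorem evalSum_zero_right (p : 𝕜⟦X⟧) : evalSum p 0 = constantCoeff p := by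
  rw [evalSum_eq_tsum, tsum_eq_single 0 fun n hn => by simp [hn]]; simp

theorem coeff_toFormalMultilinearSeries (p : 𝕜⟦X⟧) (n : ℕ) :
    (toFormalMultilinearSeries p).coeff n = coeff n p :=
  FormalMultilinearSeries.coeff_ofScalars

theorem norm_toFormalMultilinearSeries (p : 𝕜⟦X⟧) (n : ℕ) :
    ‖toFormalMultilinearSeries p n‖ = ‖coeff n p‖ :=
  FormalMultilinearSeries.ofScalars_norm 𝕜 _ n

theorem le_radius_toFormalMultilinearSeries_iff :
    r ≤ (toFormalMultilinearSeries p).radius ↔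
      ∀ t : ℝ≥0, (t : ℝ≥0∞) < r → Summable fun n => ‖coeff n p‖ * (t : ℝ) ^ n := by
  refine ⟨fun h t ht => ?_, fun h => ENNReal.le_of_forall_nnreal_lt fun t ht => ?_⟩
  · simpa only [norm_toFormalMultilinearSeries] using
      (toFormalMultilinearSeries p).summable_norm_mul_pow (ht.trans_le h)
  · refine (toFormalMultilinearSeries p).le_radius_of_summable_norm ?_
    simpa only [norm_toFormalMultilinearSeries] using h t ht

theorem coeff_mul_mul_pow {R : Type*} [CommSemiring R] (p q : R⟦X⟧) (x : R) (n : ℕ) :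
    coeff n (p * q) * x ^ n = ∑ ij ∈ Finset.HasAntidiagonal.antidiagonal n,
      coeff ij.1 p * x ^ ij.1 * (coeff ij.2 q * x ^ ij.2) := by
  rw [coeff_mul, Finset.sum_mul]
  refine Finset.sum_congr rfl fun ij hij => ?_
  rw [← Finset.HasAntidiagonal.mem_antidiagonal.mp hij, pow_add]
  ring

theorem norm_coeff_mul_le (p q : 𝕜⟦X⟧) (n : ℕ) :
    ‖coeff n (p * q)‖ ≤ coeff n ((mk fun k => ‖coeff k p‖) * mk fun k => ‖coeff k q‖) := by
  simp only [coeff_mul, coeff_mk, ← norm_mul]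
  exact norm_sum_le _ _

theorem summable_norm_coeff_mul {t : ℝ} (ht : 0 ≤ t)
    (hp : Summable fun n => ‖coeff n p‖ * t ^ n) (hq : Summable fun n => ‖coeff n q‖ * t ^ n) :
    Summable fun n => ‖coeff n (p * q)‖ * t ^ n := by
  refine .of_nonneg_of_le (fun n => by positivity)
    (fun n => mul_le_mul_of_nonneg_right (norm_coeff_mul_le p q n) (pow_nonneg ht n)) ?_
  simp only [coeff_mul_mul_pow, coeff_mk]
  exact (summable_norm_sum_mul_antidiagonal_of_summable_norm hp.norm hq.norm).of_norm

variable (𝕜 r) in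
/-- The algebra of power series whose radius of convergence is at least `r`. -/
def convergentSeries : Subalgebra 𝕜 𝕜⟦X⟧ where
  carrier := {p | r ≤ (toFormalMultilinearSeries p).radius}
  mul_mem' hp hq := by
    refine le_radius_toFormalMultilinearSeries_iff.mpr fun t ht => ?_
    exact summable_norm_coeff_mul t.coe_nonneg (le_radius_toFormalMultilinearSeries_iff.mp hp t ht)
      (le_radius_toFormalMultilinearSeries_iff.mp hq t ht)
  add_mem' {p q} hp hq := by
    have h : toFormalMultilinearSeries (p + q) =
        toFormalMultilinearSeries p + toFormalMultilinearSeries q := by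
      simp only [toFormalMultilinearSeries, map_add]
      exact FormalMultilinearSeries.ofScalars_add 𝕜 _ _
    change r ≤ (toFormalMultilinearSeries (p + q)).radius
    exact h ▸ (le_min hp hq).trans (FormalMultilinearSeries.min_radius_le_radius_add _ _)
  algebraMap_mem' c := by
    refine le_radius_toFormalMultilinearSeries_iff.mpr fun t _ =>
      summable_of_ne_finset_zero (s := {0}) fun n hn => ?_
    rw [PowerSeries.algebraMap_apply, coeff_C, if_neg (by simpa using hn)]; simp

theorem mem_convergentSeries_iff :
    p ∈ convergentSeries 𝕜 r ↔
      ∀ t : ℝ≥0, (t : ℝ≥0∞) < r → Summable fun n => ‖coeff n p‖ * (t : ℝ) ^ n :=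
  le_radius_toFormalMultilinearSeries_iff

theorem C_mem_convergentSeries (c : 𝕜) : C c ∈ convergentSeries 𝕜 r :=
  (convergentSeries 𝕜 r).algebraMap_mem c

theorem X_mem_convergentSeries : X ∈ convergentSeries 𝕜 r :=
  mem_convergentSeries_iff.mpr fun t _ => summable_of_ne_finset_zero (s := {1}) fun n hn => by
    rw [coeff_X, if_neg (by simpa using hn), norm_zero, zero_mul]

theorem convergentSeries_anti {r s : ℝ≥0∞} (h : r ≤ s) :
    convergentSeries 𝕜 s ≤ convergentSeries 𝕜 r :=
  fun _ hp => h.trans hp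

theorem mem_convergentSeries_of_norm_coeff_le (hq : q ∈ convergentSeries 𝕜 r)
    (h : ∀ n, ‖coeff n p‖ ≤ ‖coeff n q‖) : p ∈ convergentSeries 𝕜 r := by
  rw [mem_convergentSeries_iff] at hq ⊢
  exact fun t ht => .of_nonneg_of_le (fun n => by positivity)
    (fun n => mul_le_mul_of_nonneg_right (h n) (by positivity)) (hq t ht)

theorem summable_norm_coeff_mul_pow (hp : p ∈ convergentSeries 𝕜 r) (hx : ‖x‖ₑ < r) :
    Summable fun n => ‖coeff n p * x ^ n‖ := by
  simpa only [norm_mul, norm_pow, coe_nnnorm] using mem_convergentSeries_iff.mp hp ‖x‖₊ hx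

theorem toFormalMultilinearSeries_injective :
    Function.Injective (toFormalMultilinearSeries (𝕜 := 𝕜)) := fun p q h => by
  ext n
  exact congrFun (FormalMultilinearSeries.ofScalars_series_injective 𝕜 𝕜 h) n

theorem toFormalMultilinearSeries_derivative (p : 𝕜⟦X⟧) :
    toFormalMultilinearSeries (d⁄dX 𝕜 p) =
      (ContinuousLinearMap.apply 𝕜 𝕜 (1 : 𝕜)).compFormalMultilinearSeries
        (toFormalMultilinearSeries p).derivSeries := by
  refine FormalMultilinearSeries.ext fun n => ContinuousMultilinearMap.ext_ring ?_
  have h := (toFormalMultilinearSeries p).derivSeries_coeff_one n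
  rw [coeff_toFormalMultilinearSeries, nsmul_eq_mul, mul_comm] at h
  refine (coeff_toFormalMultilinearSeries (d⁄dX 𝕜 p) n).trans (Eq.trans ?_ h.symm)
  rw [coeff_derivative, Nat.cast_add_one]

theorem derivative_mem_convergentSeries (hp : p ∈ convergentSeries 𝕜 r) :
    d⁄dX 𝕜 p ∈ convergentSeries 𝕜 r := by
  change r ≤ FormalMultilinearSeries.radius _
  rw [toFormalMultilinearSeries_derivative]
  exact hp.trans ((FormalMultilinearSeries.radius_le_radius_derivSeries _).trans
    (FormalMultilinearSeries.radius_le_radius_continuousLinearMap_comp _ _))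

variable [CompleteSpace 𝕜]

theorem hasSum_evalSum (hp : p ∈ convergentSeries 𝕜 r) (hx : ‖x‖ₑ < r) :
    HasSum (fun n => coeff n p * x ^ n) (evalSum p x) :=
  evalSum_eq_tsum p x ▸ (summable_norm_coeff_mul_pow hp hx).of_norm.hasSum

theorem hasFPowerSeriesOnBall_evalSum (hp : p ∈ convergentSeries 𝕜 r) (hr : 0 < r) :
    HasFPowerSeriesOnBall (evalSum p) (toFormalMultilinearSeries p) 0 r :=
  ((toFormalMultilinearSeries p).hasFPowerSeriesOnBall (hr.trans_le hp)).mono hr hp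

theorem evalSum_add (hp : p ∈ convergentSeries 𝕜 r) (hq : q ∈ convergentSeries 𝕜 r)
    (hx : ‖x‖ₑ < r) : evalSum (p + q) x = evalSum p x + evalSum q x := by
  refine (hasSum_evalSum (add_mem hp hq) hx).unique ?_
  simpa only [map_add, add_mul] using (hasSum_evalSum hp hx).add (hasSum_evalSum hq hx)

theorem evalSum_mul (hp : p ∈ convergentSeries 𝕜 r) (hq : q ∈ convergentSeries 𝕜 r)
    (hx : ‖x‖ₑ < r) : evalSum (p * q) x = evalSum p x * evalSum q x := by
  have hp' := summable_norm_coeff_mul_pow hp hx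
  have hq' := summable_norm_coeff_mul_pow hq hx
  simp only [evalSum_eq_tsum]
  rw [tsum_mul_tsum_eq_tsum_sum_antidiagonal_of_summable_norm hp' hq']
  exact tsum_congr (coeff_mul_mul_pow p q x)

theorem hasDerivAt_evalSum (hp : p ∈ convergentSeries 𝕜 r) (hx : ‖x‖ₑ < r) :
    HasDerivAt (evalSum p) (evalSum (d⁄dX 𝕜 p) x) x := by
  have hball := hasFPowerSeriesOnBall_evalSum hp (pos_of_gt hx)
  have hx' : x ∈ Metric.eball (0 : 𝕜) r := mem_eball_zero_iff.mpr hx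
  have hderiv := (ContinuousLinearMap.apply 𝕜 𝕜 (1 : 𝕜)).comp_hasFPowerSeriesOnBall hball.fderiv
  have : deriv (evalSum p) x = evalSum (d⁄dX 𝕜 p) x := by
    rw [evalSum, toFormalMultilinearSeries_derivative]
    simpa using hderiv.sum hx'
  rw [← this]
  exact (hball.differentiableOn.differentiableAt (Metric.isOpen_eball.mem_nhds hx')).hasDerivAt

theorem continuousAt_evalSum (hp : p ∈ convergentSeries 𝕜 r) (hx : ‖x‖ₑ < r) :
    ContinuousAt (evalSum p) x :=
  (hasDerivAt_evalSum hp hx).continuousAt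

theorem eq_of_evalSum_eventuallyEq (hr : 0 < r) (hp : p ∈ convergentSeries 𝕜 r)
    (hq : q ∈ convergentSeries 𝕜 r) (h : evalSum p =ᶠ[𝓝 0] evalSum q) : p = q :=
  toFormalMultilinearSeries_injective <|
    (hasFPowerSeriesOnBall_evalSum hp hr).hasFPowerSeriesAt.eq_formalMultilinearSeries_of_eventually
      (hasFPowerSeriesOnBall_evalSum hq hr).hasFPowerSeriesAt h

theorem evalSum_inv (hp : p ∈ convergentSeries 𝕜 r) (hp' : p⁻¹ ∈ convergentSeries 𝕜 r)
    (h0 : constantCoeff p ≠ 0) (hx : ‖x‖ₑ < r) : evalSum p⁻¹ x = (evalSum p x)⁻¹ := by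
  refine eq_inv_of_mul_eq_one_right ?_
  rw [← evalSum_mul hp hp' hx, PowerSeries.mul_inv_cancel p h0, evalSum_one]

end Convergence

section Exp

theorem exp_mem_convergentSeries : exp ℝ ∈ convergentSeries ℝ ⊤ := by
  refine mem_convergentSeries_iff.mpr fun t _ =>
    (Real.summable_pow_div_factorial t).congr fun n => ?_
  rw [coeff_exp]
  simp [div_eq_inv_mul]

theorem evalSum_exp (x : ℝ) : evalSum (exp ℝ) x = Real.exp x := by
  rw [evalSum_eq_tsum, Real.exp_eq_exp_ℝ, NormedSpace.exp_eq_tsum_div]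
  exact tsum_congr fun n => by rw [coeff_exp]; simp [div_eq_inv_mul]

variable {𝕜 : Type*} [NontriviallyNormedField 𝕜]

theorem rescale_mem_convergentSeries_top {p : 𝕜⟦X⟧} (hp : p ∈ convergentSeries 𝕜 ⊤) (c : 𝕜) :
    rescale c p ∈ convergentSeries 𝕜 ⊤ := by
  refine mem_convergentSeries_iff.mpr fun t _ => ?_
  refine (mem_convergentSeries_iff.mp hp (‖c‖₊ * t) ENNReal.coe_lt_top).congr fun n => ?_
  rw [coeff_rescale, norm_mul, norm_pow, NNReal.coe_mul, coe_nnnorm]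
  ring

theorem evalSum_rescale (c : 𝕜) (p : 𝕜⟦X⟧) (x : 𝕜) :
    evalSum (rescale c p) x = evalSum p (c * x) := by
  simp only [evalSum_eq_tsum, coeff_rescale, mul_pow]
  exact tsum_congr fun n => by ring

theorem derivative_rescale {R : Type*} [CommSemiring R] (c : R) (p : R⟦X⟧) :
    d⁄dX R (rescale c p) = C c * rescale c (d⁄dX R p) := by
  ext n
  simp only [coeff_derivative, coeff_rescale, coeff_C_mul]
  ring

end Exp

section Nonneg

section Semiring

variable {R : Type*} [CommSemiring R] [PartialOrder R] [IsOrderedRing R]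

variable (R) in
/-- The power series all of whose coefficients are nonnegative. -/
def nonnegSeries : Subsemiring R⟦X⟧ where
  carrier := {p | ∀ n, 0 ≤ coeff n p}
  mul_mem' hp hq n := by
    rw [coeff_mul]
    exact Finset.sum_nonneg fun _ _ => mul_nonneg (hp _) (hq _)
  one_mem' n := by
    rw [coeff_one]
    split_ifs <;> simp
  add_mem' hp hq n := by
    rw [map_add]
    exact add_nonneg (hp n) (hq n)
  zero_mem' n := by rw [map_zero]

theorem C_mem_nonnegSeries {c : R} (hc : 0 ≤ c) : C c ∈ nonnegSeries R := fun n => by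
  rw [coeff_C]
  split_ifs <;> simp [hc]

theorem X_mem_nonnegSeries : X ∈ nonnegSeries R := fun n => by
  rw [coeff_X]
  split_ifs <;> simp

theorem derivative_mem_nonnegSeries {p : R⟦X⟧} (hp : p ∈ nonnegSeries R) :
    d⁄dX R p ∈ nonnegSeries R := fun n => by
  rw [coeff_derivative]
  exact mul_nonneg (hp _) (add_nonneg n.cast_nonneg zero_le_one)

theorem derivative_X_mul_mem_nonnegSeries {p : R⟦X⟧} (hp : p ∈ nonnegSeries R) :
    d⁄dX R (X * p) ∈ nonnegSeries R :=
  derivative_mem_nonnegSeries (mul_mem X_mem_nonnegSeries hp)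

theorem coeff_mul_nonneg {p q : R⟦X⟧} {n : ℕ} (hp : ∀ k ≤ n, 0 ≤ coeff k p)
    (hq : ∀ k ≤ n, 0 ≤ coeff k q) : 0 ≤ coeff n (p * q) := by
  rw [coeff_mul]
  exact Finset.sum_nonneg fun ij hij => mul_nonneg
    (hp _ (Finset.HasAntidiagonal.antidiagonal.fst_le hij))
    (hq _ (Finset.HasAntidiagonal.antidiagonal.snd_le hij))

theorem mem_nonnegSeries_of_coeff_succ {p : R⟦X⟧} (h0 : 0 ≤ constantCoeff p)
    (hsucc : ∀ n, (∀ k ≤ n, 0 ≤ coeff k p) → 0 ≤ coeff (n + 1) p) :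
    p ∈ nonnegSeries R := fun n => by
  induction n using Nat.strong_induction_on with
  | _ n ih =>
    cases n with
    | zero => simpa using h0
    | succ n => exact hsucc n fun k hk => ih k (Nat.lt_succ_of_le hk)

end Semiring

section Field

variable {k : Type*} [Field k] [LinearOrder k] [IsStrictOrderedRing k] {p : k⟦X⟧}

theorem mem_nonnegSeries_of_derivative_eq_mul {m : k⟦X⟧} (hm : m ∈ nonnegSeries k)
    (h0 : 0 ≤ constantCoeff p) (h : d⁄dX k p = m * p) : p ∈ nonnegSeries k := by
  refine mem_nonnegSeries_of_coeff_succ h0 fun n ih => ?_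
  have hn : coeff (n + 1) p * (n + 1) = coeff n (m * p) := by rw [← h, coeff_derivative]
  exact nonneg_of_mul_nonneg_left (hn ▸ coeff_mul_nonneg (fun i _ => hm i) ih) n.cast_add_one_pos

theorem inv_one_sub_X_mul_mem_nonnegSeries (hp : p ∈ nonnegSeries k) :
    (1 - X * p)⁻¹ ∈ nonnegSeries k := by
  have hc : constantCoeff (1 - X * p) ≠ 0 := by simp
  have hfix : (1 - X * p)⁻¹ = 1 + X * (p * (1 - X * p)⁻¹) := by
    linear_combination PowerSeries.mul_inv_cancel _ hc
  refine mem_nonnegSeries_of_coeff_succ (by simp) fun n ih => ?_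
  rw [hfix, map_add, coeff_succ_X_mul, coeff_one, if_neg n.succ_ne_zero, zero_add]
  exact coeff_mul_nonneg (fun i _ => hp i) ih

theorem mem_nonnegSeries_of_euler {c : k} (hc : 0 < c) {y s t : k⟦X⟧}
    (h : X * d⁄dX k y + C c * y = s + X * t) (hs : s ∈ nonnegSeries k)
    (ht : ∀ n, (∀ i ≤ n, 0 ≤ coeff i y) → 0 ≤ coeff n t) : y ∈ nonnegSeries k := by
  have h0 : c * constantCoeff y = constantCoeff s := by simpa using congrArg constantCoeff h
  have hsucc n : (n + 1 + c) * coeff (n + 1) y = coeff (n + 1) s + coeff n t := by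
    have := congrArg (coeff (n + 1)) h
    simp only [map_add, coeff_succ_X_mul, coeff_derivative, coeff_C_mul] at this
    linarith
  refine mem_nonnegSeries_of_coeff_succ ?_ fun n ih => ?_
  · exact nonneg_of_mul_nonneg_right (h0 ▸ by simpa using hs 0) hc
  · exact nonneg_of_mul_nonneg_right (hsucc n ▸ add_nonneg (hs _) (ht n ih)) (by positivity)

theorem sub_C_constantCoeff_mem_nonnegSeries (hp : p ∈ nonnegSeries k) :
    p - C (constantCoeff p) ∈ nonnegSeries k :=
  mem_nonnegSeries_of_coeff_succ (by simp) fun n _ => by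
    rw [map_sub, coeff_C, if_neg n.succ_ne_zero, sub_zero]
    exact hp _

end Field

variable {p q : ℝ⟦X⟧} {r : ℝ≥0∞} {x : ℝ}

theorem mem_convergentSeries_of_sub_mem_nonnegSeries (hp : p ∈ nonnegSeries ℝ)
    (hpq : q - p ∈ nonnegSeries ℝ) (hq : q ∈ convergentSeries ℝ r) : p ∈ convergentSeries ℝ r := by
  refine mem_convergentSeries_of_norm_coeff_le hq fun n => ?_
  rw [Real.norm_of_nonneg (hp n)]
  exact (sub_nonneg.mp (map_sub (coeff n) q p ▸ hpq n)).trans (le_abs_self _)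

theorem enorm_lt_ofReal_of_mem_Ico {a : ℝ} (hx : x ∈ Ico 0 a) : ‖x‖ₑ < ENNReal.ofReal a := by
  rw [Real.enorm_of_nonneg hx.1]
  exact (ENNReal.ofReal_lt_ofReal_iff (hx.1.trans_lt hx.2)).mpr hx.2

theorem coeff_mul_pow_le_evalSum (hp : p ∈ nonnegSeries ℝ) (hr : p ∈ convergentSeries ℝ r)
    (h0 : 0 ≤ x) (hx : ‖x‖ₑ < r) (n : ℕ) : coeff n p * x ^ n ≤ evalSum p x :=
  le_hasSum (hasSum_evalSum hr hx) n fun k _ => mul_nonneg (hp k) (pow_nonneg h0 k)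

theorem evalSum_nonneg (hp : p ∈ nonnegSeries ℝ) (h0 : 0 ≤ x) : 0 ≤ evalSum p x := by
  rw [evalSum_eq_tsum]
  exact tsum_nonneg fun n => mul_nonneg (hp n) (pow_nonneg h0 n)

theorem evalSum_pos (hp : p ∈ nonnegSeries ℝ) (hr : p ∈ convergentSeries ℝ r)
    (hp0 : 0 < constantCoeff p) (h0 : 0 ≤ x) (hx : ‖x‖ₑ < r) : 0 < evalSum p x :=
  hp0.trans_le (by simpa using coeff_mul_pow_le_evalSum hp hr h0 hx 0)

theorem constantCoeff_mul_lt_one_of_inv_mem_convergentSeries (hp : p ∈ nonnegSeries ℝ)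
    (hr : (1 - X * p)⁻¹ ∈ convergentSeries ℝ r) (h0 : 0 ≤ x) (hx : ‖x‖ₑ < r) :
    constantCoeff p * x < 1 := by
  have hinv := inv_one_sub_X_mul_mem_nonnegSeries hp
  have hcancel := PowerSeries.mul_inv_cancel (1 - X * p) (by simp)
  set y := (1 - X * p)⁻¹
  have hCX : C (constantCoeff p) * X ∈ convergentSeries ℝ r :=
    mul_mem (C_mem_convergentSeries _) X_mem_convergentSeries
  have hrest : y = X * ((p - C (constantCoeff p)) * y) + (1 + C (constantCoeff p) * X * y) := by
    linear_combination hcancel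
  have hsum := add_mem (one_mem _) (mul_mem hCX hr)
  have hrest_mem : X * ((p - C (constantCoeff p)) * y) ∈ convergentSeries ℝ r := by
    rw [eq_sub_of_add_eq hrest.symm]
    exact sub_mem hr hsum
  have heval := congrArg (evalSum · x) hrest
  simp only [evalSum_add hrest_mem hsum hx, evalSum_add (one_mem _) (mul_mem hCX hr) hx,
    evalSum_mul hCX hr hx, evalSum_mul (C_mem_convergentSeries _) X_mem_convergentSeries hx,
    evalSum_one, evalSum_C, evalSum_X] at heval
  have hrest_nonneg : 0 ≤ evalSum (X * ((p - C (constantCoeff p)) * y)) x := evalSum_nonneg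
    (mul_mem X_mem_nonnegSeries (mul_mem (sub_C_constantCoeff_mem_nonnegSeries hp) hinv)) h0
  nlinarith [evalSum_nonneg hinv h0]

variable {a : ℝ}

theorem derivWithin_evalSum (hp : p ∈ convergentSeries ℝ (.ofReal a)) (hx : x ∈ Ico 0 a) :
    derivWithin (evalSum p) (Ico 0 a) x = evalSum (d⁄dX ℝ p) x :=
  (hasDerivAt_evalSum hp (enorm_lt_ofReal_of_mem_Ico hx)).hasDerivWithinAt.derivWithin
    (uniqueDiffOn_Ico 0 a x hx)

theorem contDiffOn_evalSum (hp : p ∈ convergentSeries ℝ (.ofReal a)) :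
    ContDiffOn ℝ ∞ (evalSum p) (Ico 0 a) := by
  intro x hx
  have hx' := enorm_lt_ofReal_of_mem_Ico hx
  have hana := (hasFPowerSeriesOnBall_evalSum hp (pos_of_gt hx')).analyticAt_of_mem
    (mem_eball_zero_iff.mpr hx')
  exact hana.contDiffAt.contDiffWithinAt

theorem iteratedDerivWithin_evalSum_nonneg (hp : p ∈ nonnegSeries ℝ)
    (hr : p ∈ convergentSeries ℝ (.ofReal a)) (n : ℕ) (hx : x ∈ Ico 0 a) :
    0 ≤ iteratedDerivWithin n (evalSum p) (Ico 0 a) x := by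
  induction n generalizing p with
  | zero => simpa using evalSum_nonneg hp hx.1
  | succ n ih =>
    rw [iteratedDerivWithin_succ',
      iteratedDerivWithin_congr (fun y hy => derivWithin_evalSum hr hy) hx]
    exact ih (derivative_mem_nonnegSeries hp) (derivative_mem_convergentSeries hr)

theorem absolutelyMonotoneOn_of_eqOn_evalSum {φ : ℝ → ℝ} (hp : p ∈ nonnegSeries ℝ)
    (hr : p ∈ convergentSeries ℝ (.ofReal a)) (h : EqOn φ (evalSum p) (Ico 0 a)) :
    AbsolutelyMonotoneOn φ (Ico 0 a) := by
  rw [AbsolutelyMonotoneOn.iff_iteratedDerivWithin_nonneg (uniqueDiffOn_Ico 0 a)]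
  refine ⟨(contDiffOn_evalSum hr).congr h, fun n x hx => ?_⟩
  rw [iteratedDerivWithin_congr h hx]
  exact iteratedDerivWithin_evalSum_nonneg hp hr n hx

end Nonneg

section LogDeriv

variable {k : Type*} [Field k] {p q : k⟦X⟧}

/-- The formal logarithmic derivative `p' / p` of a power series, meaningful when `p` is
invertible. -/
def logDer (p : k⟦X⟧) : k⟦X⟧ :=
  d⁄dX k p * p⁻¹

theorem logDer_mul_self (hp : constantCoeff p ≠ 0) : logDer p * p = d⁄dX k p := by
  rw [logDer, mul_assoc, PowerSeries.inv_mul_cancel p hp, mul_one]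

theorem logDer_eq_of_derivative_eq_mul {m : k⟦X⟧} (hp : constantCoeff p ≠ 0)
    (h : d⁄dX k p = m * p) : logDer p = m := by
  rw [logDer, h, mul_assoc, PowerSeries.mul_inv_cancel p hp, mul_one]

theorem logDer_mul (hp : constantCoeff p ≠ 0) (hq : constantCoeff q ≠ 0) :
    logDer (p * q) = logDer p + logDer q := by
  refine logDer_eq_of_derivative_eq_mul (by simp [hp, hq]) ?_
  rw [Derivation.leibniz, smul_eq_mul, smul_eq_mul, ← logDer_mul_self hp, ← logDer_mul_self hq]
  ring

theorem logDer_inv (hp : constantCoeff p ≠ 0) : logDer p⁻¹ = -logDer p := by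
  refine logDer_eq_of_derivative_eq_mul (by simp [hp]) ?_
  rw [derivative_inv', logDer]
  ring

theorem logDer_riccati {s t u : k⟦X⟧} (hp : constantCoeff p ≠ 0)
    (h : s * d⁄dX k (d⁄dX k p) + t * d⁄dX k p + u * p = 0) :
    s * (d⁄dX k (logDer p) + logDer p * logDer p) + t * logDer p + u = 0 := by
  have h1 := logDer_mul_self hp
  have h2 := congrArg (d⁄dX k) h1
  rw [Derivation.leibniz, smul_eq_mul, smul_eq_mul] at h2
  refine (mul_eq_zero.mp ?_).resolve_right fun h0 : p = 0 => hp (by rw [h0, map_zero])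
  linear_combination h + s * h2 + (s * logDer p + t) * h1

theorem constantCoeff_rescale {R : Type*} [CommSemiring R] (c : R) (p : R⟦X⟧) :
    constantCoeff (rescale c p) = constantCoeff p := by
  simp only [← coeff_zero_eq_constantCoeff_apply, coeff_rescale, pow_zero, one_mul]

variable [Algebra ℚ k]

theorem logDer_rescale_exp (c : k) : logDer (rescale c (exp k)) = C c := by
  refine logDer_eq_of_derivative_eq_mul (by simp [constantCoeff_rescale]) ?_
  rw [derivative_rescale, derivative_exp]

/-- The product of a power series `p` with the exponential `exp (c X)` for which the linear
coefficient vanishes, that is, with `c = -p'(0) / p(0)`. -/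
def expNormalize (p : k⟦X⟧) : k⟦X⟧ :=
  rescale (-constantCoeff (logDer p)) (exp k) * p

theorem logDer_expNormalize (hp : constantCoeff p ≠ 0) :
    logDer (expNormalize p) = logDer p - C (constantCoeff (logDer p)) := by
  rw [expNormalize, logDer_mul (by simp [constantCoeff_rescale]) hp, logDer_rescale_exp, map_neg,
    neg_add_eq_sub]

theorem constantCoeff_expNormalize (p : k⟦X⟧) :
    constantCoeff (expNormalize p) = constantCoeff p := by
  simp [expNormalize, constantCoeff_rescale]

end LogDeriv

section LogDerivNonneg

variable {k : Type*} [Field k] [LinearOrder k] [IsStrictOrderedRing k] {p : k⟦X⟧}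

theorem mem_nonnegSeries_of_logDer_mem (h : logDer p ∈ nonnegSeries k)
    (h0 : 0 < constantCoeff p) : p ∈ nonnegSeries k :=
  mem_nonnegSeries_of_derivative_eq_mul h h0.le (logDer_mul_self h0.ne').symm

theorem logDer_expNormalize_mem_nonnegSeries (h : logDer p ∈ nonnegSeries k)
    (h0 : constantCoeff p ≠ 0) : logDer (expNormalize p) ∈ nonnegSeries k :=
  logDer_expNormalize h0 ▸ sub_C_constantCoeff_mem_nonnegSeries h

theorem expNormalize_mem_nonnegSeries (h : logDer p ∈ nonnegSeries k)
    (h0 : 0 < constantCoeff p) : expNormalize p ∈ nonnegSeries k :=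
  mem_nonnegSeries_of_logDer_mem (logDer_expNormalize_mem_nonnegSeries h h0.ne')
    ((constantCoeff_expNormalize p).symm ▸ h0)

end LogDerivNonneg

section LogDerivConvergence

variable {p : ℝ⟦X⟧} {r : ℝ≥0∞} {x : ℝ}

theorem expNormalize_mem_convergentSeries (hp : p ∈ convergentSeries ℝ r) :
    expNormalize p ∈ convergentSeries ℝ r :=
  mul_mem (convergentSeries_anti le_top
    (rescale_mem_convergentSeries_top exp_mem_convergentSeries _)) hp

theorem evalSum_expNormalize (hp : p ∈ convergentSeries ℝ r) (hx : ‖x‖ₑ < r) :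
    evalSum (expNormalize p) x =
      Real.exp (-(constantCoeff (logDer p) * x)) * evalSum p x := by
  rw [expNormalize, evalSum_mul (convergentSeries_anti le_top
    (rescale_mem_convergentSeries_top exp_mem_convergentSeries _)) hp hx, evalSum_rescale,
    evalSum_exp, neg_mul]

theorem hasDerivAt_log_evalSum (hp : p ∈ convergentSeries ℝ r)
    (hlog : logDer p ∈ convergentSeries ℝ r) (h0 : constantCoeff p ≠ 0) (hx : ‖x‖ₑ < r)
    (hpx : evalSum p x ≠ 0) :
    HasDerivAt (fun t => Real.log (evalSum p t)) (evalSum (logDer p) x) x := by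
  have h := (hasDerivAt_evalSum hp hx).log hpx
  rwa [← logDer_mul_self h0, evalSum_mul hlog hp hx, mul_div_cancel_right₀ _ hpx] at h

end LogDerivConvergence

section Pringsheim

section ComplexInverse

variable {P : ℂ⟦X⟧} {r : ℝ≥0∞}

theorem mem_closedBall_zero_iff_enorm_le {E : Type*} [SeminormedAddCommGroup E] {s : ℝ≥0} {z : E} :
    z ∈ Metric.closedBall 0 (s : ℝ) ↔ ‖z‖ₑ ≤ s := by
  rw [← Metric.closedEBall_coe, Metric.mem_closedEBall, edist_zero_right]

theorem toFormalMultilinearSeries_mk_coeff {𝕜 : Type*} [NontriviallyNormedField 𝕜]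
    (φ : FormalMultilinearSeries 𝕜 𝕜 𝕜) : toFormalMultilinearSeries (mk φ.coeff) = φ :=
  FormalMultilinearSeries.ext fun n => ContinuousMultilinearMap.ext_ring <|
    (coeff_toFormalMultilinearSeries _ n).trans (coeff_mk _ _)

theorem mk_coeff_mem_convergentSeries {F : ℂ → ℂ} {φ : FormalMultilinearSeries ℂ ℂ ℂ}
    (h : HasFPowerSeriesOnBall F φ 0 r) :
    mk φ.coeff ∈ convergentSeries ℂ r ∧ ∀ z, ‖z‖ₑ < r → evalSum (mk φ.coeff) z = F z := by
  have hφ := toFormalMultilinearSeries_mk_coeff φ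
  refine ⟨h.r_le.trans_eq (congrArg _ hφ).symm, fun z hz => ?_⟩
  have := h.sum (mem_eball_zero_iff.mpr hz)
  rw [evalSum, hφ, ← this, zero_add]

theorem inv_mem_convergentSeries_of_evalSum_ne_zero (hP : P ∈ convergentSeries ℂ r)
    (h0 : ∀ z, ‖z‖ₑ < r → evalSum P z ≠ 0) : P⁻¹ ∈ convergentSeries ℂ r := by
  refine mem_convergentSeries_iff.mpr fun t ht => ?_
  obtain ⟨R, htR, hRr⟩ := ENNReal.lt_iff_exists_nnreal_btwn.mp ht
  have hlt {z : ℂ} (hz : ‖z‖ₑ ≤ R) : ‖z‖ₑ < r := hz.trans_lt hRr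
  have hdiff : DifferentiableOn ℂ (fun z => (evalSum P z)⁻¹) (Metric.closedBall 0 R) :=
    fun z hz => by
      have hz : ‖z‖ₑ < r := hlt (mem_closedBall_zero_iff_enorm_le.mp hz)
      exact ((hasDerivAt_evalSum hP hz).differentiableAt.inv (h0 z hz)).differentiableWithinAt
  obtain ⟨hQ, hQ_eq⟩ := mk_coeff_mem_convergentSeries
    (hdiff.hasFPowerSeriesOnBall (ENNReal.coe_pos.mp (pos_of_gt htR)))
  set Q : ℂ⟦X⟧ := mk _
  have hPR := convergentSeries_anti hRr.le hP
  have hQP : Q * P = 1 := by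
    refine eq_of_evalSum_eventuallyEq (pos_of_gt htR) (mul_mem hQ hPR) (one_mem _) ?_
    filter_upwards [Metric.eball_mem_nhds 0 (pos_of_gt htR)] with z hz
    have hz := mem_eball_zero_iff.mp hz
    rw [evalSum_mul hQ hPR hz, hQ_eq z hz, inv_mul_cancel₀ (h0 z (hlt hz.le)), evalSum_one]
  have hP0 : constantCoeff P ≠ 0 := evalSum_zero_right P ▸ h0 0 (by simpa using pos_of_gt ht)
  rw [← (PowerSeries.eq_inv_iff_mul_eq_one hP0).mpr hQP]
  exact mem_convergentSeries_iff.mp hQ t htR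

theorem exists_lt_inv_mem_convergentSeries {s : ℝ≥0} (hP : P ∈ convergentSeries ℂ r) (hs : s < r)
    (h0 : ∀ z, ‖z‖ₑ ≤ s → evalSum P z ≠ 0) :
    ∃ s' : ℝ≥0∞, s < s' ∧ P⁻¹ ∈ convergentSeries ℂ s' := by
  have hcont : ContinuousOn (evalSum P) (Metric.eball 0 r) := fun z hz =>
    (continuousAt_evalSum hP (mem_eball_zero_iff.mp hz)).continuousWithinAt
  have hopen := hcont.isOpen_inter_preimage Metric.isOpen_eball (isOpen_compl_singleton (x := 0))
  have hsub : Metric.closedBall (0 : ℂ) s ⊆ Metric.eball 0 r ∩ evalSum P ⁻¹' {0}ᶜ := fun z hz => by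
    have hz := mem_closedBall_zero_iff_enorm_le.mp hz
    exact ⟨mem_eball_zero_iff.mpr (hz.trans_lt hs), h0 z hz⟩
  obtain ⟨δ, hδ, hδ_sub⟩ :=
    (isCompact_closedBall (0 : ℂ) s).exists_thickening_subset_open hopen hsub
  rw [thickening_closedBall hδ s.coe_nonneg, ← Metric.eball_ofReal] at hδ_sub
  refine ⟨min r (.ofReal (δ + s)), lt_min hs ?_, inv_mem_convergentSeries_of_evalSum_ne_zero
    (convergentSeries_anti (min_le_left _ _) hP) fun z hz =>
      (hδ_sub (mem_eball_zero_iff.mpr (hz.trans_le (min_le_right _ _)))).2⟩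
  rw [← ENNReal.ofReal_coe_nnreal, ENNReal.ofReal_lt_ofReal_iff (by positivity)]
  linarith

end ComplexInverse

variable {p : ℝ⟦X⟧} {r : ℝ≥0∞}

theorem norm_coeff_map_ofReal (p : ℝ⟦X⟧) (n : ℕ) :
    ‖coeff n (map Complex.ofRealHom p)‖ = ‖coeff n p‖ := by
  rw [coeff_map, Complex.ofRealHom_eq_coe, Complex.norm_real]

theorem map_ofReal_mem_convergentSeries_iff :
    map Complex.ofRealHom p ∈ convergentSeries ℂ r ↔ p ∈ convergentSeries ℝ r := by
  simp only [mem_convergentSeries_iff, norm_coeff_map_ofReal]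

theorem constantCoeff_map {R S : Type*} [CommSemiring R] [CommSemiring S] (φ : R →+* S) (p : R⟦X⟧) :
    constantCoeff (map φ p) = φ (constantCoeff p) :=
  MvPowerSeries.constantCoeff_map φ p

theorem map_inv {k K : Type*} [Field k] [Field K] (φ : k →+* K) {p : k⟦X⟧}
    (hp : constantCoeff p ≠ 0) : map φ p⁻¹ = (map φ p)⁻¹ := by
  rw [PowerSeries.eq_inv_iff_mul_eq_one (by simpa [constantCoeff_map] using hp), ← map_mul,
    PowerSeries.inv_mul_cancel p hp, map_one]

theorem norm_evalSum_map_le_of_mem_nonnegSeries {c : ℝ⟦X⟧} (hc : c ∈ nonnegSeries ℝ)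
    (hr : c ∈ convergentSeries ℝ r) {z : ℂ} (hz : ‖z‖ₑ < r) :
    ‖evalSum (map Complex.ofRealHom c) z‖ ≤ evalSum c ‖z‖ := by
  have hz' : ‖‖z‖‖ₑ < r := by rwa [enorm_norm]
  rw [evalSum_eq_tsum]
  refine tsum_of_norm_bounded (hasSum_evalSum hr hz') fun n => ?_
  rw [norm_mul, norm_pow, norm_coeff_map_ofReal, Real.norm_of_nonneg (hc n)]

theorem norm_evalSum_norm_le (hp : p ∈ convergentSeries ℝ r)
    (hc : p⁻¹ ∈ nonnegSeries ℝ) (hcr : p⁻¹ ∈ convergentSeries ℝ r) (h0 : constantCoeff p ≠ 0)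
    {z : ℂ} (hz : ‖z‖ₑ < r) :
    ‖evalSum p ‖z‖‖ ≤ ‖evalSum (map Complex.ofRealHom p) z‖ := by
  have hz' : ‖‖z‖‖ₑ < r := by rwa [enorm_norm]
  have hmul :
      ‖evalSum (map Complex.ofRealHom p) z‖ * ‖evalSum (map Complex.ofRealHom p⁻¹) z‖ = 1 := by
    rw [← norm_mul, ← evalSum_mul (map_ofReal_mem_convergentSeries_iff.mpr hp)
      (map_ofReal_mem_convergentSeries_iff.mpr hcr) hz, ← map_mul,
      PowerSeries.mul_inv_cancel p h0, map_one, evalSum_one, norm_one]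
  rw [eq_inv_of_mul_eq_one_left hmul, ← inv_inv (evalSum p ‖z‖), ← evalSum_inv hp hcr h0 hz',
    norm_inv]
  refine inv_anti₀ ((norm_nonneg _).lt_of_ne' (right_ne_zero_of_mul (hmul.trans_ne one_ne_zero))) ?_
  exact (norm_evalSum_map_le_of_mem_nonnegSeries hc hcr hz).trans (le_abs_self _)

theorem norm_evalSum_norm_le_of_enorm_le {s : ℝ≥0} (hs : s ≠ 0) (hsr : s < r)
    (hp : p ∈ convergentSeries ℝ r) (hc : p⁻¹ ∈ nonnegSeries ℝ) (hcs : p⁻¹ ∈ convergentSeries ℝ s)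
    (h0 : constantCoeff p ≠ 0) {z : ℂ} (hz : ‖z‖ₑ ≤ s) :
    ‖evalSum p ‖z‖‖ ≤ ‖evalSum (map Complex.ofRealHom p) z‖ := by
  have hclosure {w : ℂ} : w ∈ closure (Metric.ball 0 (s : ℝ)) ↔ ‖w‖ₑ ≤ s := by
    rw [closure_ball _ (NNReal.coe_ne_zero.mpr hs), mem_closedBall_zero_iff_enorm_le]
  refine le_on_closure (s := Metric.ball (0 : ℂ) s)
    (f := fun w => ‖evalSum p ‖w‖‖) (g := fun w => ‖evalSum (map Complex.ofRealHom p) w‖)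
    (fun w hw => ?_) (fun w hw => ?_) (fun w hw => ?_) (hclosure.mpr hz)
  · refine norm_evalSum_norm_le (convergentSeries_anti hsr.le hp) hc hcs h0 ?_
    rwa [← mem_eball_zero_iff, Metric.eball_coe]
  · have hw : ‖‖w‖‖ₑ < r := by rw [enorm_norm]; exact (hclosure.mp hw).trans_lt hsr
    exact ((continuousAt_evalSum hp hw).comp continuous_norm.continuousAt).norm.continuousWithinAt
  · exact (continuousAt_evalSum (map_ofReal_mem_convergentSeries_iff.mpr hp)
      ((hclosure.mp hw).trans_lt hsr)).norm.continuousWithinAt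

theorem inv_mem_convergentSeries_of_nonneg (hp : p ∈ convergentSeries ℝ r)
    (hc : p⁻¹ ∈ nonnegSeries ℝ) (h0 : ∀ x, 0 ≤ x → ‖x‖ₑ < r → evalSum p x ≠ 0) :
    p⁻¹ ∈ convergentSeries ℝ r := by
  by_contra! hn
  replace hn : (toFormalMultilinearSeries p⁻¹).radius < r := not_le.mp hn
  obtain ⟨s, hs⟩ : ∃ s : ℝ≥0, s = (toFormalMultilinearSeries p⁻¹).radius :=
    ⟨_, ENNReal.coe_toNNReal hn.ne_top⟩
  rw [← hs] at hn
  have hp0 : constantCoeff p ≠ 0 := evalSum_zero_right p ▸ h0 0 le_rfl (by simpa using pos_of_gt hn)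
  -- On every circle `p` is smallest in norm at the positive real point, as `p⁻¹` is largest there.
  have hne (z : ℂ) (hz : ‖z‖ₑ ≤ s) : evalSum (map Complex.ofRealHom p) z ≠ 0 := by
    obtain rfl | hs0 := eq_or_ne s 0
    · obtain rfl : z = 0 := by simpa using hz
      simpa [evalSum_zero_right, constantCoeff_map] using hp0
    · refine norm_pos_iff.mp ((norm_pos_iff.mpr (h0 ‖z‖ (norm_nonneg z) ?_)).trans_le
        (norm_evalSum_norm_le_of_enorm_le hs0 hn hp hc hs.le hp0 hz))
      exact (enorm_norm z).trans_lt (hz.trans_lt hn)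
  obtain ⟨s', hs', hmem⟩ := exists_lt_inv_mem_convergentSeries
    (map_ofReal_mem_convergentSeries_iff.mpr hp) hn hne
  rw [← map_inv _ hp0, map_ofReal_mem_convergentSeries_iff] at hmem
  exact hs'.not_ge (hs ▸ hmem)

end Pringsheim

section BesselSeries

variable {μ ν : ℝ}

/-- The power series `B_ν` with `J_ν(x) = x ^ ν * B_ν(x ^ 2)`. -/
def besselSeries (ν : ℝ) : ℝ⟦X⟧ :=
  mk fun n => (-1) ^ n / (2 ^ ν * 4 ^ n * (n.factorial * Real.Gamma (n + ν + 1)))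

theorem coeff_besselSeries_ne_zero (hν : -1 < ν) (n : ℕ) : coeff n (besselSeries ν) ≠ 0 := by
  have hΓ : 0 < Real.Gamma (n + ν + 1) :=
    Real.Gamma_pos_of_pos (by linarith [(n.cast_nonneg : (0 : ℝ) ≤ n)])
  rw [besselSeries, coeff_mk]
  exact div_ne_zero (by simp) (by positivity)

theorem constantCoeff_besselSeries (ν : ℝ) :
    constantCoeff (besselSeries ν) = (2 ^ ν * Real.Gamma (ν + 1))⁻¹ := by
  rw [← coeff_zero_eq_constantCoeff_apply, besselSeries, coeff_mk]
  simp

theorem constantCoeff_besselSeries_ne_zero (hν : -1 < ν) : constantCoeff (besselSeries ν) ≠ 0 := by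
  simpa using coeff_besselSeries_ne_zero hν 0

theorem coeff_succ_besselSeries (hν : -1 < ν) (n : ℕ) :
    coeff (n + 1) (besselSeries ν) =
      -(coeff n (besselSeries ν) / (4 * ((n + 1) * (n + ν + 1)))) := by
  have hn : 0 < n + ν + 1 := by linarith [(n.cast_nonneg : (0 : ℝ) ≤ n)]
  have hΓ : Real.Gamma ((n + 1 : ℕ) + ν + 1) = (n + ν + 1) * Real.Gamma (n + ν + 1) := by
    rw [← Real.Gamma_add_one hn.ne']
    push_cast
    ring_nf
  have := Real.Gamma_pos_of_pos hn
  simp only [besselSeries, coeff_mk]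
  rw [hΓ, Nat.factorial_succ, pow_succ, pow_succ]
  push_cast
  field_simp

theorem besselSeries_mem_convergentSeries (hν : -1 < ν) :
    besselSeries ν ∈ convergentSeries ℝ ⊤ := by
  refine (FormalMultilinearSeries.ofScalars_radius_eq_top_of_tendsto ℝ _
    (.of_forall (coeff_besselSeries_ne_zero hν)) ?_).ge
  have hratio (n : ℕ) : ‖coeff n.succ (besselSeries ν)‖ / ‖coeff n (besselSeries ν)‖ =
      4⁻¹ * (1 / ((n : ℝ) + 1) * (n + (ν + 1))⁻¹) := by
    have hn : 0 < n + ν + 1 := by linarith [(n.cast_nonneg : (0 : ℝ) ≤ n)]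
    have hne := norm_ne_zero_iff.mpr (coeff_besselSeries_ne_zero hν n)
    rw [coeff_succ_besselSeries hν, norm_neg, norm_div,
      Real.norm_of_nonneg (by positivity : 0 ≤ 4 * ((n + 1) * (n + ν + 1))), ← add_assoc]
    field_simp
  simp only [hratio]
  have hlim : Tendsto (fun n : ℕ => ((n : ℝ) + (ν + 1))⁻¹) atTop (𝓝 0) :=
    (tendsto_atTop_add_const_right _ _ tendsto_natCast_atTop_atTop).inv_tendsto_atTop
  simpa using (tendsto_one_div_add_atTop_nhds_zero_nat.mul hlim).const_mul 4⁻¹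

theorem besselSeries_ode (hν : -1 < ν) :
    X * d⁄dX ℝ (d⁄dX ℝ (besselSeries ν)) + C (ν + 1) * d⁄dX ℝ (besselSeries ν) +
      C (1 / 4) * besselSeries ν = 0 := by
  ext n
  have hrec : (n + 1) * (n + ν + 1) * coeff (n + 1) (besselSeries ν) =
      -(coeff n (besselSeries ν) / 4) := by
    have hn : 0 < n + ν + 1 := by linarith [(n.cast_nonneg : (0 : ℝ) ≤ n)]
    rw [coeff_succ_besselSeries hν]
    field_simp
  cases n with
  | zero =>
    simp only [LinearMap.map_add, coeff_zero_X_mul, coeff_C_mul, coeff_derivative, map_zero]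
    push_cast at hrec ⊢
    linarith
  | succ n =>
    simp only [LinearMap.map_add, coeff_succ_X_mul, coeff_C_mul, coeff_derivative, map_zero]
    push_cast at hrec ⊢
    linarith

/-- The power series `-B_ν' / B_ν`, the generating function of the Rayleigh sums
`∑ₖ j_{ν,k} ^ (-2n-2)` over the positive zeros of `J_ν`. -/
def besselRatio (ν : ℝ) : ℝ⟦X⟧ :=
  -logDer (besselSeries ν)

theorem derivative_besselSeries (hν : -1 < ν) :
    d⁄dX ℝ (besselSeries ν) = -(besselRatio ν * besselSeries ν) := by
  rw [besselRatio, neg_mul, neg_neg, logDer_mul_self (constantCoeff_besselSeries_ne_zero hν)]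

theorem besselRatio_riccati (hν : -1 < ν) :
    X * d⁄dX ℝ (besselRatio ν) + C (ν + 1) * besselRatio ν =
      C (1 / 4) + X * (besselRatio ν * besselRatio ν) := by
  have h := logDer_riccati (constantCoeff_besselSeries_ne_zero hν) (besselSeries_ode hν)
  rw [besselRatio, map_neg]
  linear_combination -h

theorem constantCoeff_besselRatio (hν : -1 < ν) :
    constantCoeff (besselRatio ν) = 1 / (4 * (ν + 1)) := by
  have h : (ν + 1) * constantCoeff (besselRatio ν) = 1 / 4 := by
    simpa using congrArg constantCoeff (besselRatio_riccati hν)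
  have : ν + 1 ≠ 0 := by linarith
  field_simp
  linarith

theorem coeff_one_besselRatio (hν : -1 < ν) :
    coeff 1 (besselRatio ν) = 1 / (16 * (ν + 1) ^ 2 * (ν + 2)) := by
  have h : (ν + 2) * coeff 1 (besselRatio ν) = (1 / (4 * (ν + 1))) ^ 2 := by
    have := congrArg (coeff (0 + 1)) (besselRatio_riccati hν)
    simp only [LinearMap.map_add, coeff_succ_X_mul, coeff_derivative, coeff_C_mul, coeff_C,
      coeff_zero_eq_constantCoeff_apply, map_mul, constantCoeff_besselRatio hν] at this
    norm_num at this ⊢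
    linarith
  have h1 : ν + 1 ≠ 0 := by linarith
  have h2 : ν + 2 ≠ 0 := by linarith
  field_simp at h ⊢
  linarith

theorem coeff_one_besselRatio_lt (hν : -1 < ν) (h : ν < μ) :
    coeff 1 (besselRatio μ) < coeff 1 (besselRatio ν) := by
  rw [coeff_one_besselRatio hν, coeff_one_besselRatio (hν.trans h)]
  have h1 : 0 < ν + 1 := by linarith
  have h2 : 0 < ν + 2 := by linarith
  gcongr

theorem besselRatio_mem_nonnegSeries (hν : -1 < ν) : besselRatio ν ∈ nonnegSeries ℝ :=
  mem_nonnegSeries_of_euler (by linarith) (besselRatio_riccati hν)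
    (C_mem_nonnegSeries (by norm_num)) fun _ ih => coeff_mul_nonneg ih ih

theorem besselRatio_sub_mem_nonnegSeries (hν : -1 < ν) (h : ν ≤ μ) :
    besselRatio ν - besselRatio μ ∈ nonnegSeries ℝ := by
  have hRν := besselRatio_mem_nonnegSeries hν
  have hRμ := besselRatio_mem_nonnegSeries (hν.trans_le h)
  have heuler : X * d⁄dX ℝ (besselRatio ν - besselRatio μ) +
      C (ν + 1) * (besselRatio ν - besselRatio μ) = C (μ - ν) * besselRatio μ +
        X * ((besselRatio ν + besselRatio μ) * (besselRatio ν - besselRatio μ)) := by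
    have hμ := besselRatio_riccati (hν.trans_le h)
    have hν := besselRatio_riccati hν
    simp only [map_sub, map_add] at hμ hν ⊢
    linear_combination hν - hμ
  exact mem_nonnegSeries_of_euler (by linarith) heuler
    (mul_mem (C_mem_nonnegSeries (sub_nonneg.mpr h)) hRμ)
    fun _ ih => coeff_mul_nonneg (fun k _ => add_mem hRν hRμ k) ih

end BesselSeries

section DiniSeries

variable {μ ν : ℝ}

/-- The power series `D_ν = B_ν + 2 X B_ν'` with `d_ν(x) = x ^ ν * D_ν(x ^ 2)`. -/
def diniSeries (ν : ℝ) : ℝ⟦X⟧ :=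
  besselSeries ν + C 2 * X * d⁄dX ℝ (besselSeries ν)

theorem diniSeries_mem_convergentSeries (hν : -1 < ν) : diniSeries ν ∈ convergentSeries ℝ ⊤ :=
  add_mem (besselSeries_mem_convergentSeries hν) <|
    mul_mem (mul_mem (C_mem_convergentSeries 2) X_mem_convergentSeries)
      (derivative_mem_convergentSeries (besselSeries_mem_convergentSeries hν))

theorem constantCoeff_diniSeries (ν : ℝ) :
    constantCoeff (diniSeries ν) = (2 ^ ν * Real.Gamma (ν + 1))⁻¹ := by
  simp [diniSeries, constantCoeff_besselSeries]

theorem constantCoeff_diniSeries_pos (hν : -1 < ν) : 0 < constantCoeff (diniSeries ν) := by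
  have := Real.Gamma_pos_of_pos (neg_lt_iff_pos_add.mp hν)
  rw [constantCoeff_diniSeries]
  positivity

/-- The power series of the quotient `J_ν / d_ν`, as a function of the squared variable. -/
def besselDivDini (ν : ℝ) : ℝ⟦X⟧ :=
  besselSeries ν * (diniSeries ν)⁻¹

theorem diniSeries_eq_mul (hν : -1 < ν) :
    diniSeries ν = besselSeries ν * (1 - X * (C 2 * besselRatio ν)) := by
  rw [diniSeries, derivative_besselSeries hν]
  ring

theorem besselDivDini_eq_inv (hν : -1 < ν) :
    besselDivDini ν = (1 - X * (C 2 * besselRatio ν))⁻¹ := by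
  rw [PowerSeries.eq_inv_iff_mul_eq_one (by simp), besselDivDini]
  linear_combination PowerSeries.mul_inv_cancel _ (constantCoeff_diniSeries_pos hν).ne' -
    (diniSeries ν)⁻¹ * diniSeries_eq_mul hν

theorem two_mul_mem_nonnegSeries {p : ℝ⟦X⟧} (hp : p ∈ nonnegSeries ℝ) :
    C 2 * p ∈ nonnegSeries ℝ :=
  mul_mem (C_mem_nonnegSeries zero_le_two) hp

theorem besselDivDini_mem_nonnegSeries (hν : -1 < ν) : besselDivDini ν ∈ nonnegSeries ℝ :=
  besselDivDini_eq_inv hν ▸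
    inv_one_sub_X_mul_mem_nonnegSeries (two_mul_mem_nonnegSeries (besselRatio_mem_nonnegSeries hν))

theorem besselDivDini_sub_mem_nonnegSeries (hν : -1 < ν) (h : ν ≤ μ) :
    besselDivDini ν - besselDivDini μ ∈ nonnegSeries ℝ := by
  have hμ := hν.trans_le h
  have hsub : besselDivDini ν - besselDivDini μ =
      X * (C 2 * (besselRatio ν - besselRatio μ)) * (besselDivDini ν * besselDivDini μ) := by
    have hKν := PowerSeries.mul_inv_cancel (1 - X * (C 2 * besselRatio ν)) (by simp)
    have hKμ := PowerSeries.mul_inv_cancel (1 - X * (C 2 * besselRatio μ)) (by simp)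
    rw [← besselDivDini_eq_inv hν] at hKν
    rw [← besselDivDini_eq_inv hμ] at hKμ
    linear_combination besselDivDini μ * hKν - besselDivDini ν * hKμ
  rw [hsub]
  exact mul_mem (mul_mem X_mem_nonnegSeries
    (two_mul_mem_nonnegSeries (besselRatio_sub_mem_nonnegSeries hν h)))
    (mul_mem (besselDivDini_mem_nonnegSeries hν) (besselDivDini_mem_nonnegSeries hμ))

/-- The power series `-D_ν' / D_ν`, the generating function of the sums `∑ₖ α_{ν,k} ^ (-2n-2)`
over the positive zeros of `d_ν`. -/
def diniRatio (ν : ℝ) : ℝ⟦X⟧ :=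
  -logDer (diniSeries ν)

theorem diniRatio_eq (hν : -1 < ν) :
    diniRatio ν = besselRatio ν + d⁄dX ℝ (X * (C 2 * besselRatio ν)) * besselDivDini ν := by
  rw [diniRatio, diniSeries_eq_mul hν, logDer_mul (constantCoeff_besselSeries_ne_zero hν) (by simp),
    besselRatio, besselDivDini_eq_inv hν, besselRatio]
  simp only [logDer, map_sub, Derivation.map_one_eq_zero]
  ring

theorem constantCoeff_diniRatio (hν : -1 < ν) :
    constantCoeff (diniRatio ν) = 3 / (4 * (ν + 1)) := by
  have h : constantCoeff (diniRatio ν) = 3 * constantCoeff (besselRatio ν) := by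
    rw [diniRatio_eq hν, besselDivDini_eq_inv hν, Derivation.leibniz]
    simp
    ring
  rw [h, constantCoeff_besselRatio hν]
  ring

theorem diniRatio_mem_nonnegSeries (hν : -1 < ν) : diniRatio ν ∈ nonnegSeries ℝ := by
  have hR := besselRatio_mem_nonnegSeries hν
  rw [diniRatio_eq hν]
  exact add_mem hR (mul_mem (derivative_X_mul_mem_nonnegSeries (two_mul_mem_nonnegSeries hR))
    (besselDivDini_mem_nonnegSeries hν))

theorem diniRatio_sub_sub_mem_nonnegSeries (hν : -1 < ν) (h : ν ≤ μ) :
    diniRatio ν - diniRatio μ - (besselRatio ν - besselRatio μ) ∈ nonnegSeries ℝ := by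
  have hμ := hν.trans_le h
  have hsub : diniRatio ν - diniRatio μ - (besselRatio ν - besselRatio μ) =
      d⁄dX ℝ (X * (C 2 * (besselRatio ν - besselRatio μ))) * besselDivDini ν +
        d⁄dX ℝ (X * (C 2 * besselRatio μ)) * (besselDivDini ν - besselDivDini μ) := by
    rw [diniRatio_eq hν, diniRatio_eq hμ, mul_sub, mul_sub, map_sub]
    ring
  rw [hsub]
  exact add_mem
    (mul_mem (derivative_X_mul_mem_nonnegSeries
      (two_mul_mem_nonnegSeries (besselRatio_sub_mem_nonnegSeries hν h)))
      (besselDivDini_mem_nonnegSeries hν))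
    (mul_mem (derivative_X_mul_mem_nonnegSeries
      (two_mul_mem_nonnegSeries (besselRatio_mem_nonnegSeries hμ)))
      (besselDivDini_sub_mem_nonnegSeries hν h))

theorem diniRatio_sub_mem_nonnegSeries (hν : -1 < ν) (h : ν ≤ μ) :
    diniRatio ν - diniRatio μ ∈ nonnegSeries ℝ := by
  simpa using add_mem (diniRatio_sub_sub_mem_nonnegSeries hν h)
    (besselRatio_sub_mem_nonnegSeries hν h)

theorem coeff_one_diniRatio_lt (hν : -1 < ν) (h : ν < μ) :
    coeff 1 (diniRatio μ) < coeff 1 (diniRatio ν) := by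
  have hle := diniRatio_sub_sub_mem_nonnegSeries hν h.le 1
  simp only [map_sub] at hle
  linarith [coeff_one_besselRatio_lt hν h]

theorem logDer_diniSeries_inv (hν : -1 < ν) : logDer (diniSeries ν)⁻¹ = diniRatio ν :=
  logDer_inv (constantCoeff_diniSeries_pos hν).ne'

theorem diniSeries_inv_mem_nonnegSeries (hν : -1 < ν) : (diniSeries ν)⁻¹ ∈ nonnegSeries ℝ :=
  mem_nonnegSeries_of_logDer_mem ((logDer_diniSeries_inv hν).symm ▸ diniRatio_mem_nonnegSeries hν)
    (by simpa using constantCoeff_diniSeries_pos hν)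

theorem exists_evalSum_diniSeries_eq_zero (hν : -1 < ν) :
    ∃ x, 0 ≤ x ∧ evalSum (diniSeries ν) x = 0 := by
  by_contra! h
  have hinv : (diniSeries ν)⁻¹ ∈ convergentSeries ℝ ⊤ := inv_mem_convergentSeries_of_nonneg
    (diniSeries_mem_convergentSeries hν) (diniSeries_inv_mem_nonnegSeries hν) fun x hx _ => h x hx
  have hdiv : (1 - X * (C 2 * besselRatio ν))⁻¹ ∈ convergentSeries ℝ ⊤ :=
    besselDivDini_eq_inv hν ▸ mul_mem (besselSeries_mem_convergentSeries hν) hinv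
  have hν' : 0 < ν + 1 := by linarith
  have hlt := constantCoeff_mul_lt_one_of_inv_mem_convergentSeries
    (two_mul_mem_nonnegSeries (besselRatio_mem_nonnegSeries hν)) hdiv
    (x := 2 * (ν + 1)) (by positivity) ENNReal.coe_lt_top
  rw [map_mul, constantCoeff_C, constantCoeff_besselRatio hν] at hlt
  field_simp at hlt
  norm_num at hlt

end DiniSeries

section Zeros

variable {ν x : ℝ}

theorem besselJ_eq (ν : ℝ) (hx : 0 < x) :
    besselJ ν x = x ^ ν * evalSum (besselSeries ν) (x ^ 2) := by
  rw [besselJ, evalSum_eq_tsum, ← tsum_mul_left]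
  refine tsum_congr fun n => ?_
  have hpow : (x / 2) ^ (2 * (n : ℝ) + ν) = (x ^ 2) ^ n / 4 ^ n * (x ^ ν / 2 ^ ν) := by
    rw [Real.rpow_add (by positivity), Real.rpow_mul (by positivity), Real.rpow_natCast,
      Real.rpow_two, div_pow, div_pow, Real.div_rpow hx.le zero_le_two]
    norm_num
  rw [hpow, besselSeries, coeff_mk]
  field_simp

theorem d_eq (hν : -1 < ν) (hx : 0 < x) :
    d ν x = x ^ ν * evalSum (diniSeries ν) (x ^ 2) := by
  have hB := besselSeries_mem_convergentSeries hν
  have hX : C 2 * X ∈ convergentSeries ℝ ⊤ :=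
    mul_mem (C_mem_convergentSeries 2) X_mem_convergentSeries
  have hlt : ‖x ^ 2‖ₑ < ⊤ := ENNReal.coe_lt_top
  have hderiv : HasDerivAt (besselJ ν) (ν * x ^ (ν - 1) * evalSum (besselSeries ν) (x ^ 2) +
      x ^ ν * (evalSum (d⁄dX ℝ (besselSeries ν)) (x ^ 2) * (2 * x))) x := by
    have hsq : HasDerivAt (fun t : ℝ => t ^ 2) (2 * x) x := by simpa using hasDerivAt_pow 2 x
    refine ((Real.hasDerivAt_rpow_const (.inl hx.ne')).mul
      ((hasDerivAt_evalSum hB hlt).comp (h := fun t : ℝ => t ^ 2) x hsq)).congr_of_eventuallyEq ?_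
    filter_upwards [Ioi_mem_nhds hx] with t ht using besselJ_eq ν ht
  have hpow : x ^ (ν - 1) * x = x ^ ν := by
    rw [Real.rpow_sub_one hx.ne', div_mul_cancel₀ _ hx.ne']
  rw [d, hderiv.deriv, besselJ_eq ν hx, diniSeries,
    evalSum_add hB (mul_mem hX (derivative_mem_convergentSeries hB)) hlt,
    evalSum_mul hX (derivative_mem_convergentSeries hB) hlt,
    evalSum_mul (C_mem_convergentSeries 2) X_mem_convergentSeries hlt, evalSum_C, evalSum_X]
  linear_combination ν * evalSum (besselSeries ν) (x ^ 2) * hpow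

theorem d_sqrt_eq (hν : -1 < ν) (hx : 0 < x) :
    d ν √x = x ^ (ν / 2) * evalSum (diniSeries ν) x := by
  rw [d_eq hν (Real.sqrt_pos.mpr hx), Real.sq_sqrt hx.le, Real.rpow_div_two_eq_sqrt _ hx.le]

theorem mem_posZeros_iff (hν : -1 < ν) :
    x ∈ posZeros ν ↔ 0 ≤ x ∧ evalSum (diniSeries ν) (x ^ 2) = 0 := by
  refine ⟨fun ⟨hx, h0⟩ => ⟨hx.le, ?_⟩, fun ⟨hx, h0⟩ => ?_⟩
  · rw [d_eq hν hx] at h0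
    exact (mul_eq_zero.mp h0).resolve_left (by positivity)
  · have hx_pos : 0 < x := hx.lt_of_ne' fun h => by
      rw [h, zero_pow two_ne_zero, evalSum_zero_right] at h0
      exact (constantCoeff_diniSeries_pos hν).ne' h0
    exact ⟨hx_pos, by rw [d_eq hν hx_pos, h0, mul_zero]⟩

theorem sqrt_mem_posZeros_iff (hν : -1 < ν) (hx : 0 ≤ x) :
    √x ∈ posZeros ν ↔ evalSum (diniSeries ν) x = 0 := by
  rw [mem_posZeros_iff hν, Real.sq_sqrt hx, and_iff_right (Real.sqrt_nonneg x)]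

theorem isClosed_posZeros (hν : -1 < ν) : IsClosed (posZeros ν) := by
  have hcont : Continuous (evalSum (diniSeries ν)) := continuous_iff_continuousAt.mpr fun _ =>
    continuousAt_evalSum (diniSeries_mem_convergentSeries hν) ENNReal.coe_lt_top
  have heq : posZeros ν = Ici 0 ∩ (fun x => evalSum (diniSeries ν) (x ^ 2)) ⁻¹' {0} :=
    Set.ext fun _ => mem_posZeros_iff hν
  rw [heq]
  exact isClosed_Ici.inter (isClosed_singleton.preimage (hcont.comp (continuous_pow 2)))

theorem isLeast_alpha₁ (hν : -1 < ν) : IsLeast (posZeros ν) (alpha₁ ν) := by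
  obtain ⟨x, hx, h0⟩ := exists_evalSum_diniSeries_eq_zero hν
  exact (isClosed_posZeros hν).isLeast_csInf ⟨√x, (sqrt_mem_posZeros_iff hν hx).mpr h0⟩
    ⟨0, fun _ hy => hy.1.le⟩

theorem evalSum_diniSeries_ne_zero (hν : -1 < ν) (hx : x ∈ domain ν) :
    evalSum (diniSeries ν) x ≠ 0 := fun h0 => by
  have hα := isLeast_alpha₁ hν
  exact (hα.2 ((sqrt_mem_posZeros_iff hν hx.1).mpr h0)).not_gt
    ((Real.sqrt_lt' hα.1.1).mpr hx.2)

end Zeros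

section Quotients

variable {μ ν x : ℝ}

theorem diniSeries_inv_mem_convergentSeries (hν : -1 < ν) :
    (diniSeries ν)⁻¹ ∈ convergentSeries ℝ (.ofReal (alpha₁ ν ^ 2)) := by
  refine inv_mem_convergentSeries_of_nonneg (convergentSeries_anti le_top
    (diniSeries_mem_convergentSeries hν)) (diniSeries_inv_mem_nonnegSeries hν) fun x hx hlt => ?_
  rw [Real.enorm_of_nonneg hx, ENNReal.ofReal_lt_ofReal_iff'] at hlt
  exact evalSum_diniSeries_ne_zero hν ⟨hx, hlt.1⟩

theorem evalSum_diniSeries_inv (hν : -1 < ν) (hx : x ∈ domain ν) :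
    evalSum (diniSeries ν)⁻¹ x = (evalSum (diniSeries ν) x)⁻¹ :=
  evalSum_inv (convergentSeries_anti le_top (diniSeries_mem_convergentSeries hν))
    (diniSeries_inv_mem_convergentSeries hν) (constantCoeff_diniSeries_pos hν).ne'
    (enorm_lt_ofReal_of_mem_Ico hx)

theorem diniRatio_mem_convergentSeries (hν : -1 < ν) :
    diniRatio ν ∈ convergentSeries ℝ (.ofReal (alpha₁ ν ^ 2)) :=
  neg_mem <| mul_mem (convergentSeries_anti le_top
    (derivative_mem_convergentSeries (diniSeries_mem_convergentSeries hν)))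
    (diniSeries_inv_mem_convergentSeries hν)

/-- The power series `D_μ / D_ν`, whose sum is `x ^ ((ν - μ) / 2) * (d_μ(√x) / d_ν(√x))`. -/
def diniQuotient (μ ν : ℝ) : ℝ⟦X⟧ :=
  diniSeries μ * (diniSeries ν)⁻¹

theorem diniQuotient_mem_convergentSeries (hμ : -1 < μ) (hν : -1 < ν) :
    diniQuotient μ ν ∈ convergentSeries ℝ (.ofReal (alpha₁ ν ^ 2)) :=
  mul_mem (convergentSeries_anti le_top (diniSeries_mem_convergentSeries hμ))
    (diniSeries_inv_mem_convergentSeries hν)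

theorem evalSum_diniQuotient (hμ : -1 < μ) (hν : -1 < ν) (hx : x ∈ domain ν) :
    evalSum (diniQuotient μ ν) x = evalSum (diniSeries μ) x / evalSum (diniSeries ν) x := by
  rw [diniQuotient, evalSum_mul (convergentSeries_anti le_top (diniSeries_mem_convergentSeries hμ))
    (diniSeries_inv_mem_convergentSeries hν) (enorm_lt_ofReal_of_mem_Ico hx),
    evalSum_diniSeries_inv hν hx, div_eq_mul_inv]

theorem constantCoeff_diniQuotient (μ ν : ℝ) : constantCoeff (diniQuotient μ ν) =
    2 ^ (ν - μ) * Real.Gamma (ν + 1) / Real.Gamma (μ + 1) := by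
  simp only [diniQuotient, map_mul, constantCoeff_inv, constantCoeff_diniSeries, inv_inv,
    Real.rpow_sub two_pos]
  ring

theorem constantCoeff_diniQuotient_pos (hμ : -1 < μ) (hν : -1 < ν) :
    0 < constantCoeff (diniQuotient μ ν) := by
  simpa [diniQuotient] using mul_pos (constantCoeff_diniSeries_pos hμ)
    (inv_pos.mpr (constantCoeff_diniSeries_pos hν))

theorem logDer_diniQuotient (hμ : -1 < μ) (hν : -1 < ν) :
    logDer (diniQuotient μ ν) = diniRatio ν - diniRatio μ := by
  rw [diniQuotient, logDer_mul (constantCoeff_diniSeries_pos hμ).ne'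
    (by simpa using (constantCoeff_diniSeries_pos hν).ne'), logDer_diniSeries_inv hν, diniRatio,
    diniRatio]
  ring

theorem logDer_diniQuotient_mem_nonnegSeries (hν : -1 < ν) (h : ν ≤ μ) :
    logDer (diniQuotient μ ν) ∈ nonnegSeries ℝ :=
  logDer_diniQuotient (hν.trans_le h) hν ▸ diniRatio_sub_mem_nonnegSeries hν h

theorem logDer_diniQuotient_mem_convergentSeries (hν : -1 < ν) (h : ν ≤ μ) :
    logDer (diniQuotient μ ν) ∈ convergentSeries ℝ (.ofReal (alpha₁ ν ^ 2)) := by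
  have hconv := diniRatio_mem_convergentSeries hν
  rw [logDer_diniQuotient (hν.trans_le h) hν]
  exact sub_mem hconv (mem_convergentSeries_of_sub_mem_nonnegSeries
    (diniRatio_mem_nonnegSeries (hν.trans_le h)) (diniRatio_sub_mem_nonnegSeries hν h) hconv)

/-- The power series of `g_{μ,ν}`. -/
def gSeries (μ ν : ℝ) : ℝ⟦X⟧ :=
  expNormalize (diniQuotient μ ν)

/-- The power series of `q_ν`. -/
def qSeries (ν : ℝ) : ℝ⟦X⟧ :=
  expNormalize (diniSeries ν)⁻¹

theorem gSeries_mem_convergentSeries (hμ : -1 < μ) (hν : -1 < ν) :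
    gSeries μ ν ∈ convergentSeries ℝ (.ofReal (alpha₁ ν ^ 2)) :=
  expNormalize_mem_convergentSeries (diniQuotient_mem_convergentSeries hμ hν)

theorem qSeries_mem_convergentSeries (hν : -1 < ν) :
    qSeries ν ∈ convergentSeries ℝ (.ofReal (alpha₁ ν ^ 2)) :=
  expNormalize_mem_convergentSeries (diniSeries_inv_mem_convergentSeries hν)

theorem gSeries_mem_nonnegSeries (hν : -1 < ν) (h : ν ≤ μ) : gSeries μ ν ∈ nonnegSeries ℝ :=
  expNormalize_mem_nonnegSeries (logDer_diniQuotient_mem_nonnegSeries hν h)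
    (constantCoeff_diniQuotient_pos (hν.trans_le h) hν)

theorem qSeries_mem_nonnegSeries (hν : -1 < ν) : qSeries ν ∈ nonnegSeries ℝ :=
  expNormalize_mem_nonnegSeries (logDer_diniSeries_inv hν ▸ diniRatio_mem_nonnegSeries hν)
    (by simpa using constantCoeff_diniSeries_pos hν)

theorem constantCoeff_gSeries_pos (hμ : -1 < μ) (hν : -1 < ν) :
    0 < constantCoeff (gSeries μ ν) := by
  rw [gSeries, constantCoeff_expNormalize]
  exact constantCoeff_diniQuotient_pos hμ hν

theorem constantCoeff_qSeries_pos (hν : -1 < ν) : 0 < constantCoeff (qSeries ν) := by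
  rw [qSeries, constantCoeff_expNormalize, constantCoeff_inv]
  exact inv_pos.mpr (constantCoeff_diniSeries_pos hν)

theorem g_eqOn (hμ : -1 < μ) (hν : -1 < ν) :
    EqOn (g μ ν) (evalSum (gSeries μ ν)) (domain ν) := fun x hx => by
  obtain rfl | hx0 := hx.1.eq_or_lt
  · rw [g, if_pos rfl, evalSum_zero_right, gSeries, constantCoeff_expNormalize,
      constantCoeff_diniQuotient]
  · have hexp : 3 * x / 4 * (1 / (μ + 1) - 1 / (ν + 1)) =
        -(constantCoeff (logDer (diniQuotient μ ν)) * x) := by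
      have h1 : μ + 1 ≠ 0 := by linarith
      have h2 : ν + 1 ≠ 0 := by linarith
      rw [logDer_diniQuotient hμ hν, map_sub, constantCoeff_diniRatio hμ,
        constantCoeff_diniRatio hν]
      field_simp
      ring
    rw [g, if_neg hx0.ne', gSeries, evalSum_expNormalize (diniQuotient_mem_convergentSeries hμ hν)
      (enorm_lt_ofReal_of_mem_Ico hx), evalSum_diniQuotient hμ hν hx, hexp, d_sqrt_eq hμ hx0,
      d_sqrt_eq hν hx0, sub_div, Real.rpow_sub hx0]
    field_simp

theorem q_eqOn (hν : -1 < ν) : EqOn (q ν) (evalSum (qSeries ν)) (domain ν) := fun x hx => by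
  obtain rfl | hx0 := hx.1.eq_or_lt
  · rw [q, if_pos rfl, evalSum_zero_right, qSeries, constantCoeff_expNormalize, constantCoeff_inv,
      constantCoeff_diniSeries, inv_inv]
  · have hexp : 3 * x / (4 * (ν + 1)) = constantCoeff (logDer (diniSeries ν)⁻¹) * x := by
      rw [logDer_diniSeries_inv hν, constantCoeff_diniRatio hν]
      ring
    rw [q, if_neg hx0.ne', qSeries, evalSum_expNormalize (diniSeries_inv_mem_convergentSeries hν)
      (enorm_lt_ofReal_of_mem_Ico hx), evalSum_diniSeries_inv hν hx, hexp, d_sqrt_eq hν hx0]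
    field_simp

theorem g_pos (hν : -1 < ν) (h : ν ≤ μ) (hx : x ∈ domain ν) : 0 < g μ ν x := by
  have hμ := hν.trans_le h
  rw [g_eqOn hμ hν hx]
  exact evalSum_pos (gSeries_mem_nonnegSeries hν h) (gSeries_mem_convergentSeries hμ hν)
    (constantCoeff_gSeries_pos hμ hν) hx.1 (enorm_lt_ofReal_of_mem_Ico hx)

theorem q_pos (hν : -1 < ν) (hx : x ∈ domain ν) : 0 < q ν x := by
  rw [q_eqOn hν hx]
  exact evalSum_pos (qSeries_mem_nonnegSeries hν) (qSeries_mem_convergentSeries hν)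
    (constantCoeff_qSeries_pos hν) hx.1 (enorm_lt_ofReal_of_mem_Ico hx)

/-- The power series of `f_{μ,ν}`. -/
def fSeries (μ ν : ℝ) : ℝ⟦X⟧ :=
  logDer (gSeries μ ν)

theorem fSeries_eq (hμ : -1 < μ) (hν : -1 < ν) : fSeries μ ν =
    logDer (diniQuotient μ ν) - C (constantCoeff (logDer (diniQuotient μ ν))) :=
  logDer_expNormalize (constantCoeff_diniQuotient_pos hμ hν).ne'

theorem fSeries_mem_nonnegSeries (hν : -1 < ν) (h : ν ≤ μ) : fSeries μ ν ∈ nonnegSeries ℝ :=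
  fSeries_eq (hν.trans_le h) hν ▸
    sub_C_constantCoeff_mem_nonnegSeries (logDer_diniQuotient_mem_nonnegSeries hν h)

theorem fSeries_mem_convergentSeries (hν : -1 < ν) (h : ν ≤ μ) :
    fSeries μ ν ∈ convergentSeries ℝ (.ofReal (alpha₁ ν ^ 2)) :=
  fSeries_eq (hν.trans_le h) hν ▸
    sub_mem (logDer_diniQuotient_mem_convergentSeries hν h) (C_mem_convergentSeries _)

theorem coeff_one_fSeries_pos (hν : -1 < ν) (h : ν < μ) : 0 < coeff 1 (fSeries μ ν) := by
  rw [fSeries_eq (hν.trans h) hν, logDer_diniQuotient (hν.trans h) hν, map_sub (coeff 1),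
    map_sub (coeff 1), coeff_C, if_neg one_ne_zero, sub_zero]
  exact sub_pos.mpr (coeff_one_diniRatio_lt hν h)

theorem f_eqOn (hν : -1 < ν) (h : ν ≤ μ) :
    EqOn (f μ ν) (evalSum (fSeries μ ν)) (domain ν) := fun x hx => by
  have hμ := hν.trans_le h
  have hg := g_eqOn hμ hν
  have hderiv := hasDerivAt_log_evalSum (gSeries_mem_convergentSeries hμ hν)
    (fSeries_mem_convergentSeries hν h) (constantCoeff_gSeries_pos hμ hν).ne'
    (enorm_lt_ofReal_of_mem_Ico hx) (hg hx ▸ (g_pos hν h hx).ne')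
  rw [f, derivWithin_congr (fun t ht => congrArg Real.log (hg ht)) (congrArg Real.log (hg hx))]
  exact hderiv.hasDerivWithinAt.derivWithin (uniqueDiffOn_Ico 0 _ x hx)

theorem f_pos (hν : -1 < ν) (h : ν < μ) (hx : x ∈ domain ν) (h0 : 0 < x) : 0 < f μ ν x := by
  rw [f_eqOn hν h.le hx]
  refine (mul_pos (coeff_one_fSeries_pos hν h) (pow_pos h0 1)).trans_le ?_
  exact coeff_mul_pow_le_evalSum (fSeries_mem_nonnegSeries hν h.le)
    (fSeries_mem_convergentSeries hν h.le) hx.1 (enorm_lt_ofReal_of_mem_Ico hx) 1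

end Quotients

end Dini

end

theorem theorem2 (μ ν : ℝ) (hν : -1 < ν) (hμν : ν ≤ μ) :
    IsLeast (Dini.posZeros ν) (Dini.alpha₁ ν) ∧
    (∀ x ∈ Dini.domain ν, 0 < Dini.g μ ν x ∧ 0 < Dini.q ν x) ∧
    (ν < μ → ∀ x ∈ Dini.domain ν, 0 < x → 0 < Dini.f μ ν x) ∧
    AbsolutelyMonotoneOn (Dini.f μ ν) (Dini.domain ν) ∧
    AbsolutelyMonotoneOn (Dini.g μ ν) (Dini.domain ν) ∧
    AbsolutelyMonotoneOn (Dini.q ν) (Dini.domain ν) :=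
  have hμ := hν.trans_le hμν
  ⟨Dini.isLeast_alpha₁ hν,
    fun _ hx => ⟨Dini.g_pos hν hμν hx, Dini.q_pos hν hx⟩,
    fun h _ hx h0 => Dini.f_pos hν h hx h0,
    Dini.absolutelyMonotoneOn_of_eqOn_evalSum (Dini.fSeries_mem_nonnegSeries hν hμν)
      (Dini.fSeries_mem_convergentSeries hν hμν) (Dini.f_eqOn hν hμν),
    Dini.absolutelyMonotoneOn_of_eqOn_evalSum (Dini.gSeries_mem_nonnegSeries hν hμν)
      (Dini.gSeries_mem_convergentSeries hμ hν) (Dini.g_eqOn hμ hν),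
    Dini.absolutelyMonotoneOn_of_eqOn_evalSum (Dini.qSeries_mem_nonnegSeries hν)
      (Dini.qSeries_mem_convergentSeries hν) (Dini.q_eqOn hν)⟩
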